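/- A skew brace $(A,\cdot,\circ)$ is a set $A$ with two group operations satisfying $a\circ(b\cdot c)=(a\circ b)\cdot a^{-1}\cdot(a\circ c)$ for all $a,b,c\in A$, where $a^{-1}$ is the inverse in $(A,\cdot)$; write $\overline a$ for the inverse in $(A,\circ)$ and $\gamma(a)(b)=a^{-1}\cdot(a\circ b)$. It is a brace if $(A,\cdot)$ is abelian, trivial if $a\cdot b=a\circ b$ for all $a,b$, and a bi-skew brace if $(A,\circ,\cdot)$ is also a skew brace. To a skew brace $A$ one associates the map $r_A(a,b)=\big(\gamma(a)(b),\ \overline{\gamma(a)(b)}\circ a\circ b\big)$ on $A\times A$. A solution $(X,r)$ is a set $X$ with a bijection $r\colon X^2\to X^2$, $r(x,y)=(\sigma_x(y),\tau_y(x))$, such that $(r\times\mathrm{id})(\mathrm{id}\times r)(r\times\mathrm{id})=(\mathrm{id}\times r)(r\times\mathrm{id})(\mathrm{id}\times r)$ and all $\sigma_x,\tau_x$ are bijective. It is involutive if $r^2=\mathrm{id}$, and trivial if $r(x,y)=(y,x)$ for all $x,y$. Write $r^{-1}(x,y)=(\hat\sigma_x(y),\hat\tau_y(x))$. Let $G(X,r)=\langle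 X\mid x\circ y=\sigma_x(y)\circ\tau_y(x)\ (x,y\in X)\rangle$ and $A(X,r)=\langle X\mid x\cdot y=y\cdot\sigma_y\hat\sigma_y^{-1}(x)\ (x,y\in X)\rangle$. The group $G(X,r)$ acts on $A(X,r)$ by automorphisms, the generator $x$ sending each generator $y$ to $\sigma_x(y)$, and the $1$-cocycle $G(X,r)\to A(X,r)$ that sends each generator to the corresponding generator is bijective. Transferring the operation of $A(X,r)$ along this bijection makes $G(X,r)$ a skew brace $(G(X,r),\cdot,\circ)$. Let $\mathcal G(X,r)$ be the subgroup of $\mathrm{Perm}(X)\times\mathrm{Perm}(X)$ generated by the pairs $(\sigma_x,\tau_x^{-1})$, $x\in X$, with the skew brace structure for which the surjective group homomorphism $\pi\colon G(X,r)\to\mathcal G(X,r)$, $\pi(x)=(\sigma_x,\tau_x^{-1})$, is a homomorphism of skew braces. The retract $\mathrm{Ret}(X,r)$ is the set $\{(\sigma_x,\tau_x^{-1})\mid x\in X\}\subseteq\mathcal G(X,r)$ with the restriction of $r_{\mathcal G(X,r)}$, which is a solution. **Proposition.** Let $(X,r)$ be an involutive solution. Then the following statements are equivalent: 1. $G(X,r)$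 is a bi-skew brace. 2. $\mathcal G(X,r)$ is a trivial brace. 3. $\mathrm{Ret}(X,r)$ is a trivial solution. -/

import Mathlib

universe u v w

namespace YangBaxter

/-! ### Skew braces -/

/-- The left brace equation `a ∘ (b · c) = (a ∘ b) · a⁻¹ · (a ∘ c)` for two group structures
`dot` and `circ` on the same set, where `a⁻¹` is the inverse for `dot`. -/
def BraceEquation {A : Type u} (dot circ : Group A) : Prop :=
  ∀ a b c : A, circ.mul a (dot.mul b c) =
    dot.mul (dot.mul (circ.mul a b) (dot.inv a)) (circ.mul a c)

/-- A skew (left) brace structure `(A, ·, ∘)` on `A`. -/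
structure SkewBrace (A : Type u) where
  /-- the additive group `(A, ·)` -/
  dotGroup : Group A
  /-- the multiplicative group `(A, ∘)` -/
  circGroup : Group A
  brace : BraceEquation dotGroup circGroup

namespace SkewBrace

variable {A : Type u} (B : SkewBrace A)

/-- `a · b` -/
def dot (a b : A) : A := B.dotGroup.mul a b

/-- `a ∘ b` -/
def circ (a b : A) : A := B.circGroup.mul a b

/-- The inverse in `(A, ·)`. -/
def dotInv (a : A) : A := B.dotGroup.inv a

/-- The inverse in `(A, ∘)`. -/
def circInv (a : A) : A := B.circGroup.inv a

/-- `γ(a)(b) = a⁻¹ · (a ∘ b)` -/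
def gamma (a b : A) : A := B.dot (B.dotInv a) (B.circ a b)

/-- `r_A (a, b) = (γ(a)(b), (γ(a)(b))‾ ∘ a ∘ b)` -/
def yb (p : A × A) : A × A :=
  (B.gamma p.1 p.2, B.circ (B.circ (B.circInv (B.gamma p.1 p.2)) p.1) p.2)

/-- `(A, ·, ∘)` is a bi-skew brace: `(A, ∘, ·)` is a skew brace too. -/
def IsBiSkew : Prop := BraceEquation B.circGroup B.dotGroup

/-- A brace is a skew brace with abelian additive group. -/
def IsBrace : Prop := ∀ a b : A, B.dot a b = B.dot b a

/-- A skew brace is trivial if its two operations coincide. -/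
def IsTrivial : Prop := ∀ a b : A, B.dot a b = B.circ a b

theorem dot_gamma (a b : A) : B.dot a (B.gamma a b) = B.circ a b := by
  let _ := B.dotGroup
  exact mul_inv_cancel_left a (B.circ a b)

theorem dot_left_cancel {a b c : A} (h : B.dot a b = B.dot a c) : b = c := by
  let _ := B.dotGroup
  exact mul_left_cancel (a := a) h

theorem circ_left_cancel {a b c : A} (h : B.circ a b = B.circ a c) : b = c := by
  let _ := B.circGroup
  exact mul_left_cancel (a := a) h

theorem circ_yb (a b : A) : B.circ (B.yb (a, b)).1 (B.yb (a, b)).2 = B.circ a b := by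
  let _ := B.circGroup
  change B.gamma a b * ((B.gamma a b)⁻¹ * a * b) = a * b
  group

theorem gamma_injective {a b c : A} (h : B.gamma a b = B.gamma a c) : b = c := by
  have h2 := congrArg (B.dot a) h
  rw [dot_gamma, dot_gamma] at h2
  exact B.circ_left_cancel h2

theorem yb_injective : Function.Injective B.yb := by
  rintro ⟨a, b⟩ ⟨c, d⟩ h
  have h1 : B.gamma a b = B.gamma c d := congrArg Prod.fst h
  have h2 : B.circ a b = B.circ c d := by rw [← circ_yb, h, circ_yb]
  rw [← dot_gamma, ← dot_gamma, h1] at h2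
  have h3 : a = c := by
    let _ := B.dotGroup
    exact mul_right_cancel (b := B.gamma c d) h2
  subst h3
  rw [B.gamma_injective h1]

/-- The maps `τ_b` of the solution of a skew brace are injective. -/
theorem yb_snd_injective {a b c : A} (h : (B.yb (a, c)).2 = (B.yb (b, c)).2) : a = b := by
  have h1 : B.circ (B.circInv (B.gamma a c)) a = B.circ (B.circInv (B.gamma b c)) b := by
    let _ := B.circGroup
    exact mul_right_cancel (b := c) h
  have key : ∀ x : A, B.circ (B.circInv x) (B.gamma x c) =
      B.dot (B.circ (B.circInv x) (B.dotInv x)) (B.dot (B.dotInv (B.circInv x)) c) := by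
    intro x
    have e := B.brace (B.circInv x) (B.dotInv x) (B.circ x c)
    have e2 : B.circGroup.mul (B.circInv x) (B.circ x c) = c := by
      let _ := B.circGroup
      exact inv_mul_cancel_left x c
    rw [e2] at e
    let _ := B.dotGroup
    exact e.trans (mul_assoc (B.circ (B.circInv x) (B.dotInv x)) (B.circInv x)⁻¹ c)
  have key2 : ∀ x : A, B.circ (B.circInv x) (B.dotInv x) =
      B.dot (B.circInv x) (B.circInv x) := by
    intro x
    have e := B.brace (B.circInv x) x (B.dotInv x)
    have e0 : B.dotGroup.mul x (B.dotInv x) = B.dotGroup.one := by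
      let _ := B.dotGroup
      exact mul_inv_cancel x
    have e1 : ∀ y : A, B.circGroup.mul y B.dotGroup.one = y := by
      intro y
      have e := B.brace y B.dotGroup.one B.dotGroup.one
      let _ := B.dotGroup
      have e' : B.circ y 1 = B.circ y 1 * y⁻¹ * B.circ y 1 := by
        have : (1 : A) * 1 = 1 := one_mul 1
        change B.circ y (1 * 1) = _ at e
        rw [this] at e
        exact e
      change B.circ y 1 = y
      have h4 : y⁻¹ * B.circ y 1 = 1 := by
        rw [mul_assoc] at e'
        exact left_eq_mul.mp e'
      exact (inv_mul_eq_one.mp h4).symm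
    have e2 : B.circGroup.mul (B.circInv x) x = B.dotGroup.one := by
      have h5 := e1 B.circGroup.one
      have h6 : B.dotGroup.one = B.circGroup.one := by
        let _ := B.circGroup
        exact (one_mul B.dotGroup.one).symm.trans h5
      rw [h6]
      let _ := B.circGroup
      exact inv_mul_cancel x
    rw [e0, e1, e2] at e
    let _ := B.dotGroup
    have e' : B.circInv x = 1 * (B.circInv x)⁻¹ * B.circ (B.circInv x) (B.dotInv x) := e
    change _ = B.circInv x * B.circInv x
    rw [one_mul, eq_inv_mul_iff_mul_eq] at e'
    exact e'.symm
  have key3 : ∀ x : A, B.circ (B.circInv x) (B.gamma x c) = B.dot (B.circInv x) c := by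
    intro x
    rw [key, key2]
    let _ := B.dotGroup
    change B.circInv x * B.circInv x * ((B.circInv x)⁻¹ * c) = B.circInv x * c
    group
  have h2 : B.dot (B.circInv a) c = B.dot (B.circInv b) c := by
    rw [← key3, ← key3]
    let _ := B.circGroup
    have h1' : (B.gamma a c)⁻¹ * a = (B.gamma b c)⁻¹ * b := h1
    have := congrArg (fun t => t⁻¹) h1'
    simp only [mul_inv_rev, inv_inv] at this
    exact this
  have h3 : B.circInv a = B.circInv b := by
    let _ := B.dotGroup
    exact mul_right_cancel (b := c) h2
  let _ := B.circGroup
  exact inv_injective (a₁ := a) (a₂ := b) h3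

/-- The group structure on `C` with `f a · f b = f (a · b)`, for a surjection `f : A → C` whose
fibres are compatible with the additive operation of `A`. -/
@[reducible] noncomputable def pushDot {C : Type v} (f : A → C) (hf : Function.Surjective f)
    (hdot : ∀ a a' b b', f a = f a' → f b = f b' → f (B.dot a b) = f (B.dot a' b')) :
    Group C :=
  letI : Mul C := ⟨fun p q => f (B.dot (Function.surjInv hf p) (Function.surjInv hf q))⟩
  letI : One C := ⟨f B.dotGroup.one⟩
  letI : Inv C := ⟨fun p => f (B.dotInv (Function.surjInv hf p))⟩
  have hm : ∀ a b : A, f a * f b = f (B.dot a b) := fun a b =>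
    hdot _ _ _ _ (Function.surjInv_eq hf _) (Function.surjInv_eq hf _)
  Group.ofLeftAxioms
    (by
      intro x y z
      obtain ⟨a, rfl⟩ := hf x
      obtain ⟨b, rfl⟩ := hf y
      obtain ⟨c, rfl⟩ := hf z
      rw [hm, hm, hm, hm]
      exact congrArg f (@mul_assoc A B.dotGroup.toSemigroup a b c))
    (by
      intro x
      obtain ⟨a, rfl⟩ := hf x
      refine (hm _ _).trans ?_
      exact congrArg f (@one_mul A B.dotGroup.toMulOneClass a))
    (by
      intro x
      have h := hm (B.dotInv (Function.surjInv hf x)) (Function.surjInv hf x)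
      rw [Function.surjInv_eq hf x] at h
      exact h.trans (congrArg f (@inv_mul_cancel A B.dotGroup (Function.surjInv hf x))))

theorem pushDot_mul {C : Type v} (f : A → C) (hf : Function.Surjective f)
    (hdot : ∀ a a' b b', f a = f a' → f b = f b' → f (B.dot a b) = f (B.dot a' b')) (a b : A) :
    (B.pushDot f hf hdot).mul (f a) (f b) = f (B.dot a b) :=
  hdot _ _ _ _ (Function.surjInv_eq hf _) (Function.surjInv_eq hf _)

/-- The skew brace structure induced on a group `C` by a surjection `f : A → C` which is a
homomorphism `(A, ∘) → C` and whose fibres are compatible with the additive operation: the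
multiplicative group is `C`, and `f a · f b = f (a · b)`. -/
noncomputable def push {C : Type v} [hC : Group C] (f : A → C) (hf : Function.Surjective f)
    (hcirc : ∀ a b, f (B.circ a b) = f a * f b)
    (hdot : ∀ a a' b b', f a = f a' → f b = f b' → f (B.dot a b) = f (B.dot a' b')) :
    SkewBrace C where
  dotGroup := B.pushDot f hf hdot
  circGroup := hC
  brace := by
    have hinv : ∀ x : C, (B.pushDot f hf hdot).inv x = f (B.dotInv (Function.surjInv hf x)) :=
      fun _ => rfl
    have hc : ∀ a b, hC.mul (f a) (f b) = f (B.circ a b) := fun a b => (hcirc a b).symm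
    intro x y z
    obtain ⟨b, rfl⟩ := hf y
    obtain ⟨c, rfl⟩ := hf z
    rw [hinv]
    have hx := Function.surjInv_eq hf x
    generalize Function.surjInv hf x = a at hx ⊢
    subst hx
    rw [pushDot_mul, hc, hc, hc, pushDot_mul, pushDot_mul]
    exact congrArg f (B.brace a b c)

theorem push_gamma {C : Type v} [Group C] (f : A → C) (hf : Function.Surjective f)
    (hcirc : ∀ a b, f (B.circ a b) = f a * f b)
    (hdot : ∀ a a' b b', f a = f a' → f b = f b' → f (B.dot a b) = f (B.dot a' b')) (a b : A) :
    (B.push f hf hcirc hdot).gamma (f a) (f b) = f (B.gamma a b) := by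
  apply (B.push f hf hcirc hdot).dot_left_cancel (a := f a)
  rw [dot_gamma]
  refine Eq.trans ?_ (B.pushDot_mul f hf hdot a (B.gamma a b)).symm
  rw [dot_gamma]
  exact (hcirc a b).symm

/-- A surjection inducing a skew brace structure is compatible with the associated solutions. -/
theorem push_yb {C : Type v} [Group C] (f : A → C) (hf : Function.Surjective f)
    (hcirc : ∀ a b, f (B.circ a b) = f a * f b)
    (hdot : ∀ a a' b b', f a = f a' → f b = f b' → f (B.dot a b) = f (B.dot a' b')) (a b : A) :
    (B.push f hf hcirc hdot).yb (f a, f b) = (f (B.yb (a, b)).1, f (B.yb (a, b)).2) := by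
  have h1 : ((B.push f hf hcirc hdot).yb (f a, f b)).1 = f (B.yb (a, b)).1 :=
    B.push_gamma f hf hcirc hdot a b
  refine Prod.ext h1 ?_
  apply (B.push f hf hcirc hdot).circ_left_cancel
    (a := ((B.push f hf hcirc hdot).yb (f a, f b)).1)
  rw [circ_yb, h1]
  refine Eq.trans ?_ (hcirc _ _)
  rw [circ_yb]
  exact (hcirc a b).symm

end SkewBrace

/-! ### Solutions of the set-theoretic Yang-Baxter equation -/

/-- `r × id` on `X × X × X` -/
def actFst {X : Type u} (r : X × X → X × X) (p : X × X × X) : X × X × X :=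
  ((r (p.1, p.2.1)).1, (r (p.1, p.2.1)).2, p.2.2)

/-- `id × r` on `X × X × X` -/
def actSnd {X : Type u} (r : X × X → X × X) (p : X × X × X) : X × X × X :=
  (p.1, r p.2)

/-- A (bijective, non-degenerate, set-theoretic) solution `(X, r)` of the Yang-Baxter equation. -/
structure Solution (X : Type u) where
  r : X × X → X × X
  bijective : Function.Bijective r
  braid : actFst r ∘ actSnd r ∘ actFst r = actSnd r ∘ actFst r ∘ actSnd r
  bijective_left : ∀ x, Function.Bijective fun y => (r (x, y)).1
  bijective_right : ∀ y, Function.Bijective fun x => (r (x, y)).2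

namespace Solution

variable {X : Type u} (S : Solution X)

/-- `r² = id` -/
def IsInvolutive : Prop := ∀ p : X × X, S.r (S.r p) = p

/-- `r (x, y) = (y, x)` -/
def IsTrivial : Prop := ∀ x y : X, S.r (x, y) = (y, x)

/-- The permutations `σ_x`, where `r (x, y) = (σ_x y, τ_y x)`. -/
noncomputable def σ (x : X) : Equiv.Perm X := Equiv.ofBijective _ (S.bijective_left x)

/-- The permutations `τ_y`, where `r (x, y) = (σ_x y, τ_y x)`. -/
noncomputable def τ (y : X) : Equiv.Perm X := Equiv.ofBijective _ (S.bijective_right y)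

theorem r_apply (x y : X) : S.r (x, y) = (S.σ x y, S.τ y x) := rfl

theorem braid_apply (x y z : X) :
    (S.σ (S.σ x y) (S.σ (S.τ y x) z), S.τ (S.σ (S.τ y x) z) (S.σ x y), S.τ z (S.τ y x)) =
      (S.σ x (S.σ y z), S.σ (S.τ (S.σ y z) x) (S.τ z y), S.τ (S.τ z y) (S.τ (S.σ y z) x)) :=
  congrFun S.braid (x, y, z)

theorem σ_σ (x y z : X) : S.σ x (S.σ y z) = S.σ (S.σ x y) (S.σ (S.τ y x) z) :=
  (congrArg Prod.fst (S.braid_apply x y z)).symm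

theorem τ_σ (x y z : X) :
    S.τ (S.σ (S.τ y x) z) (S.σ x y) = S.σ (S.τ (S.σ y z) x) (S.τ z y) :=
  congrArg (fun p => p.2.1) (S.braid_apply x y z)

theorem τ_τ (x y z : X) : S.τ z (S.τ y x) = S.τ (S.τ z y) (S.τ (S.σ y z) x) :=
  congrArg (fun p => p.2.2) (S.braid_apply x y z)

theorem σ_mul (x y : X) : S.σ x * S.σ y = S.σ (S.σ x y) * S.σ (S.τ y x) :=
  Equiv.ext fun z => S.σ_σ x y z

theorem τ_mul (y z : X) : S.τ z * S.τ y = S.τ (S.τ z y) * S.τ (S.σ y z) :=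
  Equiv.ext fun x => S.τ_τ x y z

/-- The inverse map `r⁻¹`. -/
noncomputable def rInv : X × X → X × X := (Equiv.ofBijective S.r S.bijective).symm

theorem r_rInv (p : X × X) : S.r (S.rInv p) = p :=
  (Equiv.ofBijective S.r S.bijective).apply_symm_apply p

theorem rInv_r (p : X × X) : S.rInv (S.r p) = p :=
  (Equiv.ofBijective S.r S.bijective).symm_apply_apply p

theorem rInv_eq {x y u v : X} (h1 : S.σ x y = u) (h2 : S.τ y x = v) : S.rInv (u, v) = (x, y) := by
  rw [← h1, ← h2, ← r_apply, rInv_r]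

/-- The inverse solution `(X, r⁻¹)`. -/
noncomputable def inv : Solution X where
  r := S.rInv
  bijective := (Equiv.ofBijective S.r S.bijective).symm.bijective
  braid := by
    have h1 : ∀ p, actFst S.rInv (actFst S.r p) = p := by
      rintro ⟨x, y, z⟩
      have h := S.rInv_r (x, y)
      simp only [actFst, Prod.mk.eta, h]
    have h1' : ∀ p, actFst S.r (actFst S.rInv p) = p := by
      rintro ⟨x, y, z⟩
      have h := S.r_rInv (x, y)
      simp only [actFst, Prod.mk.eta, h]
    have h2 : ∀ p, actSnd S.rInv (actSnd S.r p) = p := by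
      rintro ⟨x, y, z⟩
      simp only [actSnd, rInv_r]
    have h2' : ∀ p, actSnd S.r (actSnd S.rInv p) = p := by
      rintro ⟨x, y, z⟩
      simp only [actSnd, r_rInv]
    funext p
    obtain ⟨q, rfl⟩ : ∃ q, actFst S.r (actSnd S.r (actFst S.r q)) = p :=
      ⟨actFst S.rInv (actSnd S.rInv (actFst S.rInv p)), by simp only [h1', h2']⟩
    have hb : actFst S.r (actSnd S.r (actFst S.r q)) = actSnd S.r (actFst S.r (actSnd S.r q)) :=
      congrFun S.braid q
    simp only [Function.comp_apply, h1, h2]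
    rw [hb]
    simp only [h1, h2]
  bijective_left := by
    intro u
    constructor
    · intro v v' h
      obtain ⟨⟨x, y⟩, hp⟩ := S.bijective.2 (u, v)
      obtain ⟨⟨x', y'⟩, hp'⟩ := S.bijective.2 (u, v')
      have h' : x = x' := by
        have e : (S.rInv (u, v)).1 = (S.rInv (u, v')).1 := h
        rwa [← hp, ← hp', rInv_r, rInv_r] at e
      subst h'
      have hy : S.σ x y = S.σ x y' :=
        (congrArg Prod.fst hp).trans (congrArg Prod.fst hp').symm
      have hy' := (S.σ x).injective hy
      subst hy'
      exact (congrArg Prod.snd hp).symm.trans (congrArg Prod.snd hp')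
    · intro x
      refine ⟨S.τ ((S.σ x).symm u) x, ?_⟩
      exact congrArg Prod.fst (S.rInv_eq ((S.σ x).apply_symm_apply u) rfl)
  bijective_right := by
    intro v
    constructor
    · intro u u' h
      obtain ⟨⟨x, y⟩, hp⟩ := S.bijective.2 (u, v)
      obtain ⟨⟨x', y'⟩, hp'⟩ := S.bijective.2 (u', v)
      have h' : y = y' := by
        have e : (S.rInv (u, v)).2 = (S.rInv (u', v)).2 := h
        rwa [← hp, ← hp', rInv_r, rInv_r] at e
      subst h'
      have hx : S.τ y x = S.τ y x' :=
        (congrArg Prod.snd hp).trans (congrArg Prod.snd hp').symm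
      have hx' := (S.τ y).injective hx
      subst hx'
      exact (congrArg Prod.fst hp).symm.trans (congrArg Prod.fst hp')
    · intro y
      refine ⟨S.σ ((S.τ y).symm v) y, ?_⟩
      exact congrArg Prod.snd (S.rInv_eq rfl ((S.τ y).apply_symm_apply v))

theorem inv_σ {x y u v : X} (h1 : S.σ x y = u) (h2 : S.τ y x = v) : S.inv.σ u v = x :=
  congrArg Prod.fst (S.rInv_eq h1 h2)

theorem inv_τ {x y u v : X} (h1 : S.σ x y = u) (h2 : S.τ y x = v) : S.inv.τ v u = y :=
  congrArg Prod.snd (S.rInv_eq h1 h2)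

/-- If `f : X → A` is a homomorphism from `(X, r)` to the solution `(A, r_A)` of a skew brace `A`,
then `r_A` restricts to a solution on the image of `f`. -/
def image {A : Type v} (B : SkewBrace A) (f : X → A)
    (hf : ∀ x y, B.yb (f x, f y) = (f (S.r (x, y)).1, f (S.r (x, y)).2)) :
    Solution (Set.range f) where
  r p := (⟨(B.yb (p.1, p.2)).1, by
      obtain ⟨⟨_, x, rfl⟩, ⟨_, y, rfl⟩⟩ := p
      rw [hf]
      exact ⟨_, rfl⟩⟩,
    ⟨(B.yb (p.1, p.2)).2, by
      obtain ⟨⟨_, x, rfl⟩, ⟨_, y, rfl⟩⟩ := p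
      rw [hf]
      exact ⟨_, rfl⟩⟩)
  bijective := by
    constructor
    · rintro ⟨a, b⟩ ⟨c, d⟩ h
      have h1 := congrArg (fun q => ((q.1 : A), (q.2 : A))) h
      have h2 := B.yb_injective h1
      exact Prod.ext (Subtype.ext (congrArg Prod.fst h2)) (Subtype.ext (congrArg Prod.snd h2))
    · rintro ⟨⟨_, u, rfl⟩, ⟨_, v, rfl⟩⟩
      obtain ⟨⟨x, y⟩, hp⟩ := S.bijective.2 (u, v)
      refine ⟨(⟨f x, x, rfl⟩, ⟨f y, y, rfl⟩), ?_⟩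
      apply Prod.ext <;> apply Subtype.ext <;> simp [hf, hp]
  braid := by
    funext p
    obtain ⟨⟨_, x, rfl⟩, ⟨_, y, rfl⟩, ⟨_, z, rfl⟩⟩ := p
    have h := S.braid_apply x y z
    simp only [Prod.mk.injEq] at h
    obtain ⟨h1, h2, h3⟩ := h
    simp only [Function.comp_apply, actFst, actSnd, hf, r_apply, h1, h2, h3]
  bijective_left := by
    rintro ⟨_, x, rfl⟩
    constructor
    · rintro a b h
      exact Subtype.ext (B.gamma_injective (congrArg Subtype.val h))
    · rintro ⟨_, u, rfl⟩
      refine ⟨⟨f ((S.σ x).symm u), _, rfl⟩, Subtype.ext ?_⟩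
      simp [hf, r_apply]
  bijective_right := by
    rintro ⟨_, y, rfl⟩
    constructor
    · rintro a b h
      exact Subtype.ext (B.yb_snd_injective (congrArg Subtype.val h))
    · rintro ⟨_, v, rfl⟩
      refine ⟨⟨f ((S.τ y).symm v), _, rfl⟩, Subtype.ext ?_⟩
      simp [hf, r_apply]

theorem perm_apply_inv {Y : Type v} (f : Equiv.Perm Y) (y : Y) : f (f⁻¹ y) = y :=
  f.apply_symm_apply y

theorem perm_inv_apply {Y : Type v} (f : Equiv.Perm Y) (y : Y) : f⁻¹ (f y) = y :=
  f.symm_apply_apply y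

/-! ### The structure group and its skew brace structure -/

/-- The relators of `⟨X | x ∘ y = σ_x(y) ∘ τ_y(x)⟩`. -/
def structureRels : Set (FreeGroup X) :=
  Set.range fun p : X × X =>
    FreeGroup.of p.1 * FreeGroup.of p.2 *
      (FreeGroup.of (S.σ p.1 p.2) * FreeGroup.of (S.τ p.2 p.1))⁻¹

/-- The structure group `G(X, r) = ⟨X | x ∘ y = σ_x(y) ∘ τ_y(x)⟩`. -/
abbrev StructureGroup : Type u := PresentedGroup S.structureRels

/-- The relators of `⟨X | x · y = y · σ_y(σ̂_y⁻¹(x))⟩`, where `r⁻¹(x, y) = (σ̂_x(y), τ̂_y(x))`. -/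
def derivedRels : Set (FreeGroup X) :=
  Set.range fun p : X × X =>
    FreeGroup.of p.1 * FreeGroup.of p.2 *
      (FreeGroup.of p.2 * FreeGroup.of (S.σ p.2 ((S.inv.σ p.2)⁻¹ p.1)))⁻¹

/-- The derived structure group `A(X, r) = ⟨X | x · y = y · σ_y(σ̂_y⁻¹(x))⟩`. -/
abbrev DerivedGroup : Type u := PresentedGroup S.derivedRels

/-- The canonical map `X → G(X, r)`. -/
def ι (x : X) : S.StructureGroup := PresentedGroup.of x

/-- The canonical map `X → A(X, r)`. -/
def δ (x : X) : S.DerivedGroup := PresentedGroup.of x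

theorem ι_mul (x y : X) : S.ι x * S.ι y = S.ι (S.σ x y) * S.ι (S.τ y x) :=
  mul_inv_eq_one.mp (PresentedGroup.one_of_mem ⟨(x, y), rfl⟩)

theorem δ_mul (x y : X) : S.δ x * S.δ y = S.δ y * S.δ (S.σ y ((S.inv.σ y)⁻¹ x)) :=
  mul_inv_eq_one.mp (PresentedGroup.one_of_mem ⟨(x, y), rfl⟩)

/-- The homomorphism out of `G(X, r)` given on generators. -/
def structureLift {H : Type v} [Group H] (f : X → H)
    (hf : ∀ x y, f x * f y = f (S.σ x y) * f (S.τ y x)) : S.StructureGroup →* H :=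
  PresentedGroup.toGroup (f := f) (by
    rintro _ ⟨⟨x, y⟩, rfl⟩
    simpa [mul_inv_eq_one, ← mul_inv_rev] using mul_inv_eq_one.mpr (hf x y))

@[simp] theorem structureLift_ι {H : Type v} [Group H] (f : X → H)
    (hf : ∀ x y, f x * f y = f (S.σ x y) * f (S.τ y x)) (x : X) :
    S.structureLift f hf (S.ι x) = f x :=
  PresentedGroup.toGroup.of _

/-- The homomorphism out of `A(X, r)` given on generators. -/
def derivedLift {H : Type v} [Group H] (f : X → H)
    (hf : ∀ x y, f x * f y = f y * f (S.σ y ((S.inv.σ y)⁻¹ x))) : S.DerivedGroup →* H :=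
  PresentedGroup.toGroup (f := f) (by
    rintro _ ⟨⟨x, y⟩, rfl⟩
    simpa [mul_inv_eq_one, ← mul_inv_rev] using mul_inv_eq_one.mpr (hf x y))

@[simp] theorem derivedLift_δ {H : Type v} [Group H] (f : X → H)
    (hf : ∀ x y, f x * f y = f y * f (S.σ y ((S.inv.σ y)⁻¹ x))) (x : X) :
    S.derivedLift f hf (S.δ x) = f x :=
  PresentedGroup.toGroup.of _

theorem structure_induction {p : S.StructureGroup → Prop} (hι : ∀ x, p (S.ι x)) (h1 : p 1)
    (hmul : ∀ g h, p g → p h → p (g * h)) (hinv : ∀ g, p g → p g⁻¹) (g : S.StructureGroup) :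
    p g := by
  have hg : g ∈ Subgroup.closure (Set.range S.ι) := by
    have : Subgroup.closure (Set.range S.ι) = ⊤ := PresentedGroup.closure_range_of _
    rw [this]
    trivial
  induction hg using Subgroup.closure_induction with
  | mem x hx =>
    obtain ⟨y, rfl⟩ := hx
    exact hι y
  | one => exact h1
  | mul x y _ _ hx hy => exact hmul x y hx hy
  | inv x _ hx => exact hinv x hx

theorem derived_induction {p : S.DerivedGroup → Prop} (hδ : ∀ x, p (S.δ x)) (h1 : p 1)
    (hmul : ∀ g h, p g → p h → p (g * h)) (hinv : ∀ g, p g → p g⁻¹) (g : S.DerivedGroup) :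
    p g := by
  have hg : g ∈ Subgroup.closure (Set.range S.δ) := by
    have : Subgroup.closure (Set.range S.δ) = ⊤ := PresentedGroup.closure_range_of _
    rw [this]
    trivial
  induction hg using Subgroup.closure_induction with
  | mem x hx =>
    obtain ⟨y, rfl⟩ := hx
    exact hδ y
  | one => exact h1
  | mul x y _ _ hx hy => exact hmul x y hx hy
  | inv x _ hx => exact hinv x hx

/-- The homomorphism `G(X, r) → Perm X × Perm X` with `x ↦ (σ_x, τ_x⁻¹)`. -/
noncomputable def permHom : S.StructureGroup →* Equiv.Perm X × Equiv.Perm X :=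
  S.structureLift (fun x => (S.σ x, (S.τ x)⁻¹)) (by
    intro x y
    refine Prod.ext (S.σ_mul x y) ?_
    change (S.τ x)⁻¹ * (S.τ y)⁻¹ = (S.τ (S.σ x y))⁻¹ * (S.τ (S.τ y x))⁻¹
    rw [← mul_inv_rev, ← mul_inv_rev, S.τ_mul])

@[simp] theorem permHom_ι (x : X) : S.permHom (S.ι x) = (S.σ x, (S.τ x)⁻¹) :=
  S.structureLift_ι _ _ x

/-- The action of `G(X, r)` on `X` by the permutations `σ_x`. -/
noncomputable def sig : S.StructureGroup →* Equiv.Perm X :=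
  (MonoidHom.fst _ _).comp S.permHom

@[simp] theorem sig_ι (x : X) : S.sig (S.ι x) = S.σ x :=
  congrArg Prod.fst (S.permHom_ι x)

/-- The map `ψ_y(x) = σ_y(σ̂_y⁻¹(x))`. -/
noncomputable def ψ (y x : X) : X := S.σ y ((S.inv.σ y)⁻¹ x)

theorem ψ_eq (x y : X) : S.ψ (S.σ x y) x = S.σ (S.σ x y) (S.τ y x) := by
  unfold ψ
  congr 1
  rw [Equiv.Perm.inv_eq_iff_eq]
  exact (S.inv_σ rfl rfl).symm

theorem σ_ψ (z x y : X) : S.σ z (S.ψ y x) = S.ψ (S.σ z y) (S.σ z x) := by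
  obtain ⟨t, rfl⟩ := (S.σ x).surjective y
  rw [ψ_eq, S.σ_σ z, ← S.τ_σ, S.σ_σ z x t, ψ_eq]

theorem sig_ψ (g : S.StructureGroup) :
    ∀ x y, S.sig g (S.ψ y x) = S.ψ (S.sig g y) (S.sig g x) := by
  induction g using S.structure_induction with
  | hι z => simpa using fun x y => S.σ_ψ z x y
  | h1 => simp
  | hmul g h hg hh => intro x y; simp [hg, hh]
  | hinv g hg =>
    intro x y
    rw [map_inv, Equiv.Perm.inv_eq_iff_eq, hg]
    simp

/-- The endomorphism of `A(X, r)` induced by `sig g`. -/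
noncomputable def actHom (g : S.StructureGroup) : S.DerivedGroup →* S.DerivedGroup :=
  S.derivedLift (fun x => S.δ (S.sig g x)) (by
    intro x y
    rw [S.δ_mul]
    exact congrArg (fun t => S.δ (S.sig g y) * S.δ t) (S.sig_ψ g x y).symm)

theorem actHom_δ (g : S.StructureGroup) (x : X) : S.actHom g (S.δ x) = S.δ (S.sig g x) :=
  S.derivedLift_δ _ _ x

theorem actHom_one (a : S.DerivedGroup) : S.actHom 1 a = a := by
  induction a using S.derived_induction with
  | hδ x => simp [actHom_δ]
  | h1 => simp
  | hmul a b ha hb => simp [ha, hb]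
  | hinv a ha => simp [ha]

theorem actHom_mul (g h : S.StructureGroup) (a : S.DerivedGroup) :
    S.actHom (g * h) a = S.actHom g (S.actHom h a) := by
  induction a using S.derived_induction with
  | hδ x => simp [actHom_δ]
  | h1 => simp
  | hmul a b ha hb => simp [ha, hb]
  | hinv a ha => simp [ha]

/-- The action of `G(X, r)` on `A(X, r)` by automorphisms, with `x` sending the generator `y`
to the generator `σ_x(y)`. -/
noncomputable def act : S.StructureGroup →* MulAut S.DerivedGroup where
  toFun g :=
    { toFun := S.actHom g
      invFun := S.actHom g⁻¹
      left_inv := fun a => by rw [← actHom_mul, inv_mul_cancel, actHom_one]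
      right_inv := fun a => by rw [← actHom_mul, mul_inv_cancel, actHom_one]
      map_mul' := map_mul _ }
  map_one' := MulEquiv.ext fun a => S.actHom_one a
  map_mul' g h := MulEquiv.ext fun a => S.actHom_mul g h a

theorem act_δ (g : S.StructureGroup) (x : X) : S.act g (S.δ x) = S.δ (S.sig g x) :=
  S.actHom_δ g x

/-- The homomorphism `G(X, r) → A(X, r) ⋊ G(X, r)` with `x ↦ (x, x)`. -/
noncomputable def graphHom : S.StructureGroup →* S.DerivedGroup ⋊[S.act] S.StructureGroup :=
  S.structureLift (fun x => ⟨S.δ x, S.ι x⟩) (by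
    intro x y
    apply SemidirectProduct.ext
    · simp only [SemidirectProduct.mul_left, act_δ, sig_ι]
      rw [S.δ_mul]
      exact congrArg (fun t => S.δ (S.σ x y) * S.δ t) (S.ψ_eq x y)
    · exact S.ι_mul x y)

theorem graphHom_right (g : S.StructureGroup) : (S.graphHom g).right = g := by
  induction g using S.structure_induction with
  | hι z => simp [graphHom]
  | h1 => simp
  | hmul g h hg hh => simp [hg, hh]
  | hinv g hg => simp [hg]

/-- The 1-cocycle `G(X, r) → A(X, r)` sending each generator to the corresponding generator. -/
noncomputable def cocycle (g : S.StructureGroup) : S.DerivedGroup := (S.graphHom g).left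

theorem cocycle_ι (x : X) : S.cocycle (S.ι x) = S.δ x := by
  simp [cocycle, graphHom]

theorem cocycle_mul (g h : S.StructureGroup) :
    S.cocycle (g * h) = S.cocycle g * S.act g (S.cocycle h) := by
  simp [cocycle, graphHom_right]

theorem cocycle_one : S.cocycle 1 = 1 := by
  simp [cocycle]

/-- The action of `G(X, r)` on `X` by the permutations `τ̂_x⁻¹`. -/
noncomputable def invTau : S.StructureGroup →* Equiv.Perm X :=
  S.structureLift (fun x => (S.inv.τ x)⁻¹) (by
    intro u v
    have h := S.inv.τ_mul (S.σ u v) (S.τ v u)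
    rw [S.inv_σ rfl rfl, S.inv_τ rfl rfl] at h
    rw [← mul_inv_rev, ← mul_inv_rev, h])

theorem invTau_τ (x t : X) : S.invTau (S.ι (S.τ t x)) t = S.σ x t := by
  rw [invTau, structureLift_ι, Equiv.Perm.inv_eq_iff_eq]
  exact (S.inv_τ rfl rfl).symm

theorem ι_eq_of_τ {x x' t : X} (h : S.ι (S.τ t x) = S.ι (S.τ t x')) : S.ι x = S.ι x' := by
  have h1 : S.σ x t = S.σ x' t := by rw [← invTau_τ, h, invTau_τ]
  have h2 := S.ι_mul x t
  rw [h, h1, ← S.ι_mul] at h2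
  exact mul_right_cancel h2

/-- The map `g ↦ g ∘ σ_g⁻¹(x)`, which is right multiplication by `x` in the additive group. -/
noncomputable def rightMul (x : X) (g : S.StructureGroup) : S.StructureGroup :=
  g * S.ι ((S.sig g)⁻¹ x)

theorem rightMul_injective (x : X) : Function.Injective (S.rightMul x) := by
  intro g h hgh
  unfold rightMul at hgh
  have hs := congrArg S.sig hgh
  simp only [map_mul, sig_ι] at hs
  set u := (S.sig g)⁻¹ x with hu
  set v := (S.sig h)⁻¹ x with hv
  have hz : (S.σ u)⁻¹ u = (S.σ v)⁻¹ v := by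
    conv_lhs => rw [hu]
    conv_rhs => rw [hv]
    rw [← hu, ← hv, ← Equiv.Perm.mul_apply, ← Equiv.Perm.mul_apply, ← mul_inv_rev,
      ← mul_inv_rev, hs]
  have e1 : S.ι ((S.σ u)⁻¹ u) = S.ι (S.τ ((S.σ u)⁻¹ u) u) := by
    have := S.ι_mul u ((S.σ u)⁻¹ u)
    rw [perm_apply_inv] at this
    exact mul_left_cancel this
  have e2 : S.ι ((S.σ v)⁻¹ v) = S.ι (S.τ ((S.σ v)⁻¹ v) v) := by
    have := S.ι_mul v ((S.σ v)⁻¹ v)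
    rw [perm_apply_inv] at this
    exact mul_left_cancel this
  rw [← hz] at e2
  have e3 := S.ι_eq_of_τ (e1.symm.trans e2)
  rw [e3] at hgh
  exact mul_right_cancel hgh

theorem rightMul_surjective (x : X) : Function.Surjective (S.rightMul x) := by
  intro g
  set z := (S.sig g)⁻¹ x with hz
  set y := (S.τ z)⁻¹ z with hy
  refine ⟨g * (S.ι y)⁻¹, ?_⟩
  unfold rightMul
  have h1 : (S.sig (g * (S.ι y)⁻¹))⁻¹ x = S.σ y z := by
    simp [hz]
  have h2 := S.ι_mul y z
  have h3 : S.τ z y = z := by simp [hy]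
  rw [h3] at h2
  rw [h1, ← mul_right_cancel h2]
  group

theorem rightMul_rightMul (x y : X) (g : S.StructureGroup) :
    S.rightMul y (S.rightMul x g) = S.rightMul (S.ψ y x) (S.rightMul y g) := by
  obtain ⟨x, rfl⟩ := (S.sig g).surjective x
  obtain ⟨y, rfl⟩ := (S.sig g).surjective y
  obtain ⟨z, rfl⟩ := (S.σ x).surjective y
  rw [← sig_ψ, ψ_eq]
  simp [rightMul, mul_assoc, S.ι_mul x z]

/-- The permutation `rightMul x`. -/
noncomputable def rightMulPerm (x : X) : Equiv.Perm S.StructureGroup :=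
  Equiv.ofBijective (S.rightMul x) ⟨S.rightMul_injective x, S.rightMul_surjective x⟩

/-- The action of `A(X, r)` on `G(X, r)` by inverses of right multiplications. -/
noncomputable def derivedAct : S.DerivedGroup →* Equiv.Perm S.StructureGroup :=
  S.derivedLift (fun x => (S.rightMulPerm x)⁻¹) (by
    intro x y
    rw [← mul_inv_rev, ← mul_inv_rev]
    congr 1
    exact Equiv.ext fun g => S.rightMul_rightMul x y g)

theorem derivedAct_δ (x : X) (g : S.StructureGroup) :
    (S.derivedAct (S.δ x))⁻¹ g = g * S.ι ((S.sig g)⁻¹ x) := by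
  rw [derivedAct, derivedLift_δ, inv_inv]
  rfl

theorem cocycle_derivedAct (a : S.DerivedGroup) :
    ∀ g, S.cocycle ((S.derivedAct a)⁻¹ g) = S.cocycle g * a := by
  induction a using S.derived_induction with
  | hδ x =>
    intro g
    rw [derivedAct_δ, cocycle_mul, cocycle_ι, act_δ, perm_apply_inv]
  | h1 => simp
  | hmul a b ha hb =>
    intro g
    rw [map_mul, mul_inv_rev, Equiv.Perm.mul_apply, hb, ha, mul_assoc]
  | hinv a ha =>
    intro g
    rw [eq_mul_inv_iff_mul_eq, ← ha]
    simp

theorem derivedAct_cocycle (g : S.StructureGroup) :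
    ∀ h, (S.derivedAct (S.act h (S.cocycle g)))⁻¹ h = h * g := by
  induction g using S.structure_induction with
  | hι x =>
    intro h
    rw [cocycle_ι, act_δ, derivedAct_δ, perm_inv_apply]
  | h1 => simp [cocycle_one]
  | hmul g k hg hk =>
    intro h
    rw [cocycle_mul, map_mul, map_mul, mul_inv_rev, Equiv.Perm.mul_apply, hg,
      ← MulAut.mul_apply, ← map_mul, hk, mul_assoc]
  | hinv g hg =>
    intro h
    have e : S.act h (S.cocycle g⁻¹) = (S.act (h * g⁻¹) (S.cocycle g))⁻¹ := by
      have e1 := S.cocycle_mul g⁻¹ g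
      rw [inv_mul_cancel, cocycle_one] at e1
      rw [eq_inv_of_mul_eq_one_left e1.symm, map_inv, map_mul, MulAut.mul_apply]
    rw [e, map_inv, inv_inv]
    have e2 := hg (h * g⁻¹)
    rw [Equiv.Perm.inv_eq_iff_eq] at e2
    rw [inv_mul_cancel_right] at e2
    exact e2.symm

/-- The bijection `G(X, r) → A(X, r)` along which the group structure is transferred. -/
noncomputable def cocycleEquiv : S.StructureGroup ≃ S.DerivedGroup where
  toFun := S.cocycle
  invFun a := (S.derivedAct a)⁻¹ 1
  left_inv g := by simpa using S.derivedAct_cocycle g 1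
  right_inv a := by rw [cocycle_derivedAct, cocycle_one, one_mul]

/-- The structure skew brace `(G(X, r), ·, ∘)`: the multiplicative group is the structure group
`G(X, r)`, the additive group is transferred from `A(X, r)` along the bijection
`cocycleEquiv`. -/
noncomputable def structureBrace : SkewBrace S.StructureGroup where
  dotGroup := S.cocycleEquiv.group
  circGroup := inferInstance
  brace := by
    intro a b c
    apply S.cocycleEquiv.injective
    change S.cocycle (a * S.cocycleEquiv.symm (S.cocycle b * S.cocycle c)) =
      S.cocycleEquiv (S.cocycleEquiv.symm (S.cocycleEquiv (S.cocycleEquiv.symm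
        (S.cocycle (a * b) * S.cocycleEquiv (S.cocycleEquiv.symm (S.cocycle a)⁻¹))) *
        S.cocycle (a * c)))
    have h : ∀ x, S.cocycle (S.cocycleEquiv.symm x) = x := S.cocycleEquiv.apply_symm_apply
    simp only [Equiv.apply_symm_apply, cocycle_mul, h, map_mul]
    group

theorem structureBrace_circ (a b : S.StructureGroup) : S.structureBrace.circ a b = a * b := rfl

theorem cocycle_dot (a b : S.StructureGroup) :
    S.cocycle (S.structureBrace.dot a b) = S.cocycle a * S.cocycle b :=
  S.cocycleEquiv.apply_symm_apply _

theorem cocycle_gamma (a b : S.StructureGroup) :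
    S.cocycle (S.structureBrace.gamma a b) = S.act a (S.cocycle b) := by
  have h := congrArg S.cocycle (S.structureBrace.dot_gamma a b)
  rw [cocycle_dot, structureBrace_circ, cocycle_mul] at h
  exact mul_left_cancel h

theorem cocycle_injective : Function.Injective S.cocycle := S.cocycleEquiv.injective

theorem structureBrace_yb (x y : X) :
    S.structureBrace.yb (S.ι x, S.ι y) = (S.ι (S.σ x y), S.ι (S.τ y x)) := by
  have h : S.structureBrace.gamma (S.ι x) (S.ι y) = S.ι (S.σ x y) := by
    apply S.cocycle_injective
    rw [cocycle_gamma, cocycle_ι, cocycle_ι, act_δ, sig_ι]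
  refine Prod.ext h ?_
  change (S.structureBrace.gamma (S.ι x) (S.ι y))⁻¹ * S.ι x * S.ι y = _
  rw [h, mul_assoc, S.ι_mul]
  simp

/-! ### The permutation skew brace and the retract -/

/-- The permutation group `𝒢(X, r)`, generated by the pairs `(σ_x, τ_x⁻¹)`. -/
def permGroup : Subgroup (Equiv.Perm X × Equiv.Perm X) :=
  Subgroup.closure (Set.range fun x => (S.σ x, (S.τ x)⁻¹))

theorem permHom_mem (g : S.StructureGroup) : S.permHom g ∈ S.permGroup := by
  induction g using S.structure_induction with
  | hι x => exact Subgroup.subset_closure ⟨x, (S.permHom_ι x).symm⟩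
  | h1 => rw [map_one]; exact one_mem _
  | hmul g h hg hh => rw [map_mul]; exact mul_mem hg hh
  | hinv g hg => rw [map_inv]; exact inv_mem hg

/-- The homomorphism `π : G(X, r) → 𝒢(X, r)` with `π(x) = (σ_x, τ_x⁻¹)`. -/
noncomputable def π : S.StructureGroup →* S.permGroup :=
  S.permHom.codRestrict S.permGroup S.permHom_mem

theorem π_surjective : Function.Surjective S.π := by
  rintro ⟨p, hp⟩
  have : S.permGroup ≤ S.permHom.range := by
    refine (Subgroup.closure_le _).mpr ?_
    rintro _ ⟨x, rfl⟩
    exact ⟨S.ι x, S.permHom_ι x⟩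
  obtain ⟨g, hg⟩ := this hp
  exact ⟨g, Subtype.ext hg⟩

theorem gamma_mul (a g h : S.StructureGroup) {t : S.StructureGroup}
    (ht : a * g = S.structureBrace.gamma a g * t) :
    S.structureBrace.gamma a (g * h) =
      S.structureBrace.gamma a g * S.structureBrace.gamma t h := by
  apply S.cocycle_injective
  rw [cocycle_gamma, cocycle_mul, cocycle_mul, cocycle_gamma, cocycle_gamma, map_mul,
    ← MulAut.mul_apply, ← MulAut.mul_apply, ← map_mul, ← map_mul, ht]

theorem gamma_one (a : S.StructureGroup) : S.structureBrace.gamma a 1 = 1 := by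
  apply S.cocycle_injective
  rw [cocycle_gamma, cocycle_one, map_one]

theorem ι_mul_eq (g : S.StructureGroup) :
    ∀ x, S.ι x * g = S.structureBrace.gamma (S.ι x) g * S.ι ((S.permHom g).2⁻¹ x) := by
  induction g using S.structure_induction with
  | hι y =>
    intro x
    have h := congrArg Prod.fst (S.structureBrace_yb x y)
    change S.structureBrace.gamma (S.ι x) (S.ι y) = S.ι (S.σ x y) at h
    rw [h, S.ι_mul]
    simp
  | h1 => simp [gamma_one]
  | hmul g h hg hh =>
    intro x
    rw [S.gamma_mul _ _ _ (hg x), mul_assoc]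
    have := hh ((S.permHom g).2⁻¹ x)
    rw [map_mul, Prod.snd_mul, mul_inv_rev, Equiv.Perm.mul_apply, ← this, ← mul_assoc, hg x,
      mul_assoc]
  | hinv g hg =>
    intro x
    have h1 := hg ((S.permHom g).2 x)
    rw [perm_inv_apply] at h1
    have h2 := S.gamma_mul _ _ g⁻¹ h1
    rw [mul_inv_cancel, gamma_one] at h2
    rw [eq_inv_of_mul_eq_one_right h2.symm, map_inv, Prod.snd_inv, inv_inv,
      eq_inv_mul_iff_mul_eq, ← mul_assoc, ← h1]
    group

theorem gamma_of_ker (g : S.StructureGroup) :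
    ∀ k, S.permHom k = 1 → S.structureBrace.gamma g k = g * k * g⁻¹ := by
  induction g using S.structure_induction with
  | hι x =>
    intro k hk
    have h := S.ι_mul_eq k x
    rw [hk] at h
    simp only [Prod.snd_one, inv_one, Equiv.Perm.coe_one, id_eq] at h
    exact eq_mul_inv_of_mul_eq h.symm
  | h1 =>
    intro k _
    apply S.cocycle_injective
    simp [cocycle_gamma]
  | hmul g h hg hh =>
    intro k hk
    have h1 : S.structureBrace.gamma (g * h) k =
        S.structureBrace.gamma g (S.structureBrace.gamma h k) := by
      apply S.cocycle_injective
      simp [cocycle_gamma]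
    rw [h1, hh k hk, hg _ (by simp [hk])]
    group
  | hinv g hg =>
    intro k hk
    have h1 := hg (g⁻¹ * k * g) (by simp [hk])
    apply S.cocycle_injective
    have h2 := congrArg S.cocycle h1
    rw [cocycle_gamma] at h2
    rw [cocycle_gamma, map_inv, MulAut.inv_apply, MulEquiv.symm_apply_eq, inv_inv, h2]
    congr 1
    group

theorem act_of_ker {k : S.StructureGroup} (hk : S.permHom k = 1) (a : S.DerivedGroup) :
    S.act k a = a := by
  have hs : S.sig k = 1 := congrArg Prod.fst hk
  induction a using S.derived_induction with
  | hδ x => simp [act_δ, hs]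
  | h1 => simp
  | hmul a b ha hb => simp [ha, hb]
  | hinv a ha => simp [ha]

theorem cocycle_ker_comm {k : S.StructureGroup} (hk : S.permHom k = 1) (g : S.StructureGroup) :
    S.cocycle g * S.cocycle k = S.cocycle k * S.cocycle g := by
  have h1 := congrArg S.cocycle (S.gamma_of_ker g (g⁻¹ * k * g) (by simp [hk]))
  have h2 : g * (g⁻¹ * k * g) * g⁻¹ = k := by group
  rw [h2, cocycle_gamma] at h1
  have h3 := S.cocycle_mul k g
  rw [S.act_of_ker hk] at h3
  rw [← h3, ← h1, ← cocycle_mul]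
  congr 1
  group

/-- The kernel of `π` is compatible with the additive operation of `G(X, r)`. -/
theorem π_dot (a a' b b' : S.StructureGroup) (ha : S.π a = S.π a') (hb : S.π b = S.π b') :
    S.π (S.structureBrace.dot a b) = S.π (S.structureBrace.dot a' b') := by
  have ha1 : S.permHom a = S.permHom a' := congrArg Subtype.val ha
  have hb1 : S.permHom b = S.permHom b' := congrArg Subtype.val hb
  obtain ⟨k, rfl⟩ : ∃ k, k * a = a' := ⟨a' * a⁻¹, by group⟩
  obtain ⟨l, rfl⟩ : ∃ l, l * b = b' := ⟨b' * b⁻¹, by group⟩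
  have hk : S.permHom k = 1 := by simpa using ha1
  have hl : S.permHom l = 1 := by simpa using hb1
  have h : S.structureBrace.dot (k * a) (l * b) = k * l * S.structureBrace.dot a b := by
    apply S.cocycle_injective
    rw [cocycle_dot, cocycle_mul, cocycle_mul, cocycle_mul, cocycle_mul, cocycle_dot,
      S.act_of_ker hk, S.act_of_ker hk, S.act_of_ker hl, S.act_of_ker (k := k * l) (by simp [hk, hl])]
    rw [mul_assoc, ← mul_assoc (S.cocycle a), S.cocycle_ker_comm hl a]
    simp only [mul_assoc]
  rw [h]
  apply Subtype.ext
  change S.permHom _ = S.permHom _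
  simp [hk, hl]

/-- The permutation skew brace `𝒢(X, r)`: the multiplicative group is the permutation group and
the additive operation is the one induced from `G(X, r)` along `π`. -/
noncomputable def permBrace : SkewBrace S.permGroup :=
  S.structureBrace.push S.π S.π_surjective (fun a b => map_mul S.π a b) S.π_dot

/-- The retract `Ret(X, r)`: the restriction of the solution of the skew brace `𝒢(X, r)` to the
image of `x ↦ π(x) = (σ_x, τ_x⁻¹)`. -/
noncomputable def retract : Solution (Set.range fun x => S.π (S.ι x)) :=
  S.image S.permBrace (fun x => S.π (S.ι x)) (by
    intro x y
    refine (S.structureBrace.push_yb S.π S.π_surjective (fun a b => map_mul S.π a b) S.π_dot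
      (S.ι x) (S.ι y)).trans ?_
    rw [structureBrace_yb]
    rfl)

end Solution
end YangBaxter

/-! All three statements are compared with one condition on the permutations: (*) `σ_{σ_x(y)} = σ_y`
for all `x, y`.

From 1 to (*). The cocycle turns the bi-skew identity into `γ(a · b) = γ(b) γ(a)`, whereas `γ(a ∘ b)
= γ(a) γ(b)` always holds. Involutivity makes `A(X, r)` free abelian on `X`, so `x ∘ y = x · σ_x(y)
= σ_x(y) · x`. Computing `γ` of this element in both ways gives `γ(x) γ(σ_x(y)) = γ(x) γ(y)`, and
(*) follows because `X` embeds in `A(X, r)`.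

From (*) to 1 and 2. Under (*) the permutations `σ_x` commute, so `x ↦ σ_x` extends to a
homomorphism `A(X, r) → Perm X`, and this homomorphism is invariant under `G(X, r)`. Hence the
action `sig` on `X` is multiplicative for `·` as well as for `∘`, with commuting values (`sig_dot`,
`sig_comm`). This gives the bi-skew identity. Moreover (*) forces `τ_x⁻¹ = σ_x`, so `π` sees only
`sig`, and the two operations coincide in `𝒢(X, r)`.

From 2 to 3, the solution of a trivial brace is the flip. From 3 to (*), the first component of the
flip on the retract reads `π(σ_x(y)) = π(y)`. -/

namespace YangBaxter

namespace SkewBrace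

variable {A : Type u} {B : SkewBrace A}

/-- The solution associated with a trivial brace is the flip map. -/
theorem yb_eq_swap (hb : B.IsBrace) (ht : B.IsTrivial) (a b : A) : B.yb (a, b) = (b, a) := by
  have h1 : (B.yb (a, b)).1 = b := by
    apply B.dot_left_cancel (a := a)
    exact (B.dot_gamma a b).trans (ht a b).symm
  refine Prod.ext h1 ?_
  -- The two components of `r_A (a, b)` have `∘`-product `a ∘ b`, which equals `b ∘ a` in a trivial
  -- brace.
  apply B.circ_left_cancel (a := b)
  have h2 := B.circ_yb a b
  rw [h1] at h2
  rw [h2, ← ht, ← ht, hb]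

end SkewBrace

namespace Solution

variable {X : Type u} {S : Solution X}

/-! ### The derived group of an involutive solution -/

theorem IsInvolutive.σ_σ_τ (hS : S.IsInvolutive) (x y : X) : S.σ (S.σ x y) (S.τ y x) = x :=
  congrArg Prod.fst (hS (x, y))

/-- Writing `y = σ_x(t)`, the value `ψ_y(x)` is the first coordinate of `r² (x, t)`. The defining
relations of `A(X, r)` thus become plain commutation of generators. -/
theorem IsInvolutive.ψ_eq_self (hS : S.IsInvolutive) (x y : X) : S.ψ y x = x := by
  obtain ⟨t, rfl⟩ := (S.σ x).surjective y
  rw [ψ_eq, hS.σ_σ_τ]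

/-- For an involutive solution, `A(X, r)` is free abelian on `X`; in particular the generators
are distinct. -/
theorem IsInvolutive.δ_injective (hS : S.IsInvolutive) : Function.Injective S.δ := by
  let F : S.DerivedGroup →* Multiplicative (FreeAbelianGroup X) :=
    S.derivedLift (fun x => Multiplicative.ofAdd (FreeAbelianGroup.of x)) (by
      intro x y
      have h : S.σ y ((S.inv.σ y)⁻¹ x) = x := hS.ψ_eq_self x y
      rw [h, mul_comm])
  intro x y h
  have h2 := congrArg F h
  simp only [F, derivedLift_δ] at h2
  exact FreeAbelianGroup.of_injective h2

theorem IsInvolutive.derived_comm (hS : S.IsInvolutive) (a b : S.DerivedGroup) :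
    a * b = b * a := by
  have h : ∀ x y, Commute (S.δ x) (S.δ y) := by
    intro x y
    have h := S.δ_mul x y
    have h' : S.σ y ((S.inv.σ y)⁻¹ x) = x := hS.ψ_eq_self x y
    rwa [h'] at h
  have h1 : ∀ x b, Commute (S.δ x) b := by
    intro x b
    induction b using S.derived_induction with
    | hδ y => exact h x y
    | h1 => exact Commute.one_right _
    | hmul a b ha hb => exact ha.mul_right hb
    | hinv a ha => exact ha.inv_right
  change Commute a b
  induction a using S.derived_induction with
  | hδ x => exact h1 x b
  | h1 => exact Commute.one_left _
  | hmul a b ha hb => exact ha.mul_left hb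
  | hinv a ha => exact ha.inv_left

theorem IsInvolutive.structureBrace_isBrace (hS : S.IsInvolutive) :
    S.structureBrace.IsBrace := by
  intro a b
  apply S.cocycle_injective
  rw [cocycle_dot, cocycle_dot, hS.derived_comm]

/-! ### The bi-skew identity in terms of the action -/

theorem act_congr {g h : S.StructureGroup} (hgh : S.sig g = S.sig h) : S.act g = S.act h := by
  ext a
  induction a using S.derived_induction with
  | hδ x => rw [act_δ, act_δ, hgh]
  | h1 => simp
  | hmul a b ha hb => simp [ha, hb]
  | hinv a ha => simp [ha]

/-- Injectivity of `δ` is what lets an equality of automorphisms of `A(X, r)` be read off on `X`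
itself. -/
theorem sig_eq_of_act_eq (hδ : Function.Injective S.δ) {g h : S.StructureGroup}
    (hgh : S.act g = S.act h) : S.sig g = S.sig h := by
  ext x
  apply hδ
  rw [← act_δ, ← act_δ, hgh]

/-- With `z` the cocycle, both sides of the bi-skew identity for `a, b, c` have image beginning with
`z(a) z(b)`. The remaining factors are `b` acting on `z(c)` and `(a · b) ∘ a⁻¹` acting on `z(c)`,
with `a⁻¹` the `∘`-inverse. As `z` is onto, the identity compares two automorphisms. -/
theorem structureBrace_isBiSkew_iff_act : S.structureBrace.IsBiSkew ↔
    ∀ a b, S.act (S.structureBrace.dot a b) = S.act b * S.act a := by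
  have key : ∀ a c, S.cocycle (a⁻¹ * S.structureBrace.dot a c) = S.act a⁻¹ (S.cocycle c) := by
    intro a c
    have h := S.cocycle_mul a⁻¹ a
    rw [inv_mul_cancel, cocycle_one] at h
    rw [cocycle_mul, cocycle_dot, map_mul, ← mul_assoc, ← h, one_mul]
  have key2 : ∀ a b c, S.structureBrace.dot a (b * c) =
      S.structureBrace.dot a b * a⁻¹ * S.structureBrace.dot a c ↔
      S.act b (S.cocycle c) = S.act (S.structureBrace.dot a b) (S.act a⁻¹ (S.cocycle c)) := by
    intro a b c
    rw [← S.cocycle_injective.eq_iff, mul_assoc, cocycle_mul, key, cocycle_dot, cocycle_dot,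
      cocycle_mul, mul_assoc, mul_right_inj, mul_right_inj]
  constructor
  · intro h a b
    rw [← mul_inv_eq_iff_eq_mul]
    ext c
    obtain ⟨c, rfl⟩ := S.cocycleEquiv.surjective c
    rw [← map_inv]
    exact ((key2 a b c).mp (h a b c)).symm
  · intro h a b c
    refine (key2 a b c).mpr ?_
    rw [h, map_inv]
    simp

/-! ### Consequences of `σ_{σ_x(y)} = σ_y` -/

/-- Involutivity gives `σ_{σ_x(y)}(τ_y(x)) = x`, where the hypothesis replaces the outer permutation
by `σ_y`. -/
theorem IsInvolutive.τ_eq_inv_σ (hS : S.IsInvolutive) (h : ∀ x y, S.σ (S.σ x y) = S.σ y) (y : X) :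
    S.τ y = (S.σ y)⁻¹ := by
  ext x
  rw [Equiv.Perm.eq_inv_iff_eq, ← h x y, hS.σ_σ_τ]

theorem IsInvolutive.σ_τ (hS : S.IsInvolutive) (h : ∀ x y, S.σ (S.σ x y) = S.σ y) (x y : X) :
    S.σ (S.τ y x) = S.σ x := by
  rw [hS.τ_eq_inv_σ h, ← h y ((S.σ y)⁻¹ x), perm_apply_inv]

theorem IsInvolutive.σ_comm (hS : S.IsInvolutive) (h : ∀ x y, S.σ (S.σ x y) = S.σ y) (x y : X) :
    S.σ x * S.σ y = S.σ y * S.σ x := by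
  rw [S.σ_mul, h, hS.σ_τ h]

theorem σ_sig (h : ∀ x y, S.σ (S.σ x y) = S.σ y) (g : S.StructureGroup) :
    ∀ x, S.σ (S.sig g x) = S.σ x := by
  induction g using S.structure_induction with
  | hι z => simpa using h z
  | h1 => simp
  | hmul g k hg hk => simp [hg, hk]
  | hinv g hg =>
    intro x
    rw [map_inv, ← hg, perm_apply_inv]

/-- The homomorphism `sig` factors through the cocycle as `F ∘ cocycle` with `F` a homomorphism on
`A(X, r)`; since the cocycle carries `·` to the product of `A(X, r)`, `sig` respects `·`. -/
theorem IsInvolutive.sig_dot (hS : S.IsInvolutive) (h : ∀ x y, S.σ (S.σ x y) = S.σ y)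
    (a b : S.StructureGroup) : S.sig (S.structureBrace.dot a b) = S.sig a * S.sig b := by
  let F : S.DerivedGroup →* Equiv.Perm X := S.derivedLift S.σ (by
    intro x y
    have h' : S.σ y ((S.inv.σ y)⁻¹ x) = x := hS.ψ_eq_self x y
    rw [h', hS.σ_comm h])
  have hF : ∀ x, F (S.δ x) = S.σ x := fun x => S.derivedLift_δ _ _ x
  -- Invariance of `F` removes the twist in the cocycle identity, so that `F ∘ cocycle` is a
  -- homomorphism for `∘` and can be compared with `sig` on generators.
  have h1 : ∀ g a, F (S.act g a) = F a := by
    intro g a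
    induction a using S.derived_induction with
    | hδ x => rw [act_δ, hF, hF, σ_sig h]
    | h1 => simp
    | hmul a b ha hb => simp [ha, hb]
    | hinv a ha => simp [ha]
  have h2 : S.sig = { toFun := fun g => F (S.cocycle g)
                      map_one' := by rw [cocycle_one, map_one]
                      map_mul' := fun g k => by rw [cocycle_mul, map_mul, h1] } := by
    apply PresentedGroup.ext
    intro x
    exact (S.sig_ι x).trans (((congrArg F (S.cocycle_ι x)).trans (hF x)).symm)
  have h3 : ∀ g, S.sig g = F (S.cocycle g) := fun g => DFunLike.congr_fun h2 g
  rw [h3, cocycle_dot, map_mul, ← h3, ← h3]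

/-- The values of `sig` commute because `sig` is multiplicative on the abelian group `(G(X, r), ·)`.
-/
theorem IsInvolutive.sig_comm (hS : S.IsInvolutive) (h : ∀ x y, S.σ (S.σ x y) = S.σ y)
    (a b : S.StructureGroup) : S.sig a * S.sig b = S.sig b * S.sig a := by
  rw [← hS.sig_dot h, hS.structureBrace_isBrace, hS.sig_dot h]

theorem IsInvolutive.permHom_eq (hS : S.IsInvolutive) (h : ∀ x y, S.σ (S.σ x y) = S.σ y)
    (g : S.StructureGroup) : S.permHom g = (S.sig g, S.sig g) := by
  have : S.permHom = S.sig.prod S.sig := by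
    apply PresentedGroup.ext
    intro x
    refine (S.permHom_ι x).trans ?_
    rw [hS.τ_eq_inv_σ h, inv_inv]
    exact (Prod.ext (S.sig_ι x) (S.sig_ι x)).symm
  rw [this]
  rfl

/-! ### The three statements against `σ_{σ_x(y)} = σ_y` -/

theorem permBrace_dot (a b : S.StructureGroup) :
    S.permBrace.dot (S.π a) (S.π b) = S.π (S.structureBrace.dot a b) :=
  S.structureBrace.pushDot_mul S.π S.π_surjective S.π_dot a b

/-- An involutive solution has a bi-skew structure brace iff `σ_{σ_x(y)} = σ_y` for all `x, y`. -/
theorem IsInvolutive.structureBrace_isBiSkew_iff (hS : S.IsInvolutive) :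
    S.structureBrace.IsBiSkew ↔ ∀ x y, S.σ (S.σ x y) = S.σ y := by
  rw [structureBrace_isBiSkew_iff_act]
  constructor
  · intro h x y
    have hs : ∀ a b, S.sig (S.structureBrace.dot a b) = S.sig b * S.sig a := by
      intro a b
      rw [← map_mul]
      exact sig_eq_of_act_eq hS.δ_injective ((h a b).trans (map_mul _ _ _).symm)
    -- This is `a · γ(a)(b) = a ∘ b` on generators.
    have hd : S.structureBrace.dot (S.ι x) (S.ι (S.σ x y)) = S.ι x * S.ι y := by
      have h1 := S.structureBrace.dot_gamma (S.ι x) (S.ι y)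
      have h2 : S.structureBrace.gamma (S.ι x) (S.ι y) = S.ι (S.σ x y) :=
        congrArg Prod.fst (S.structureBrace_yb x y)
      rwa [h2] at h1
    -- The factors are taken in swapped order so that the order-reversing rule puts `σ_x` on the
    -- left, where it cancels against `σ_x σ_y`; commutativity of `·` restores the order needed for
    -- `hd`.
    have h1 := hs (S.ι (S.σ x y)) (S.ι x)
    rw [hS.structureBrace_isBrace, hd, map_mul, sig_ι, sig_ι, sig_ι] at h1
    exact (mul_left_cancel h1).symm
  · intro h a b
    rw [← map_mul]
    apply act_congr
    rw [hS.sig_dot h, map_mul, hS.sig_comm h]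

/-- If `σ_{σ_x(y)} = σ_y` for all `x, y`, then the permutation skew brace of an involutive
solution is a trivial brace. -/
theorem IsInvolutive.permBrace_trivial (hS : S.IsInvolutive)
    (h : ∀ x y, S.σ (S.σ x y) = S.σ y) : S.permBrace.IsBrace ∧ S.permBrace.IsTrivial := by
  constructor
  · intro p q
    obtain ⟨a, rfl⟩ := S.π_surjective p
    obtain ⟨b, rfl⟩ := S.π_surjective q
    rw [permBrace_dot, permBrace_dot, hS.structureBrace_isBrace]
  · intro p q
    obtain ⟨a, rfl⟩ := S.π_surjective p
    obtain ⟨b, rfl⟩ := S.π_surjective q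
    rw [permBrace_dot]
    refine Eq.trans ?_ (map_mul S.π a b)
    apply Subtype.ext
    change S.permHom _ = S.permHom _
    -- Both components of `permHom` equal `sig`, which is multiplicative for either operation.
    rw [hS.permHom_eq h, hS.permHom_eq h, hS.sig_dot h, map_mul]

theorem retract_isTrivial_of_permBrace (hb : S.permBrace.IsBrace) (ht : S.permBrace.IsTrivial) :
    S.retract.IsTrivial := by
  intro p q
  have h := SkewBrace.yb_eq_swap hb ht p.1 q.1
  exact Prod.ext (Subtype.ext (congrArg Prod.fst h)) (Subtype.ext (congrArg Prod.snd h))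

/-- The map `x ↦ π(x)` carries `r` to the solution of `𝒢(X, r)`, so triviality on its image gives
`π(σ_x(y)) = π(y)`, whose first coordinate is the claim. -/
theorem σ_σ_of_retract_isTrivial (h : S.retract.IsTrivial) (x y : X) :
    S.σ (S.σ x y) = S.σ y := by
  have h1 : (S.permBrace.yb (S.π (S.ι x), S.π (S.ι y))).1 = S.π (S.ι y) :=
    congrArg (fun p => (p.1 : S.permGroup)) (h ⟨S.π (S.ι x), x, rfl⟩ ⟨S.π (S.ι y), y, rfl⟩)
  have h2 := S.structureBrace.push_yb S.π S.π_surjective (fun a b => map_mul S.π a b) S.π_dot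
    (S.ι x) (S.ι y)
  rw [structureBrace_yb] at h2
  have h3 : S.π (S.ι (S.σ x y)) = S.π (S.ι y) := (congrArg Prod.fst h2).symm.trans h1
  have h4 : S.permHom (S.ι (S.σ x y)) = S.permHom (S.ι y) := congrArg Subtype.val h3
  rw [permHom_ι, permHom_ι] at h4
  exact congrArg Prod.fst h4

end Solution
end YangBaxter

theorem mainTheorem11 {X : Type u} (S : YangBaxter.Solution X) (hS : S.IsInvolutive) :
    List.TFAE [
      S.structureBrace.IsBiSkew,
      S.permBrace.IsBrace ∧ S.permBrace.IsTrivial,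
      S.retract.IsTrivial] := by
  tfae_have 1 → 2 := fun h => hS.permBrace_trivial (hS.structureBrace_isBiSkew_iff.mp h)
  tfae_have 2 → 3 := fun h => YangBaxter.Solution.retract_isTrivial_of_permBrace h.1 h.2
  tfae_have 3 → 1 := fun h => hS.structureBrace_isBiSkew_iff.mpr
    (YangBaxter.Solution.σ_σ_of_retract_isTrivial h)
  tfae_finish
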